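/- Let $\beta>0$ and let $G$ be a meromorphic function on $\mathbb{C}$ (a retarded correlator at fixed momentum) such that - $G$ is holomorphic at every $\omega$ with $\operatorname{Im}\omega\ge 0$, and $\overline{G(\omega)}=G(-\bar\omega)$; - all poles $\omega_n^+$ and all zeroes $\omega_n^-$ of $G$ are simple, and $G(0)\neq 0$. Put $\rho(\omega)=\frac{G(\omega)-G(-\omega)}{2i}$. Assume: 1. (Power-law asymptotics.) There are positive radii $R_0<R_1<\cdots$ with $R_N\to\infty$ and a constant $C$ such that, for every $N$, the circle $|\omega|=R_N$ contains no pole and no zero of $G$, and $\max_{|\omega|=R_N}|G'(\omega)/G(\omega)|\le C/R_N$. 2. (Thermal product hypothesis.) The function $\sinh(\beta\omega/2)/\rho(\omega)$ is (after removing removable singularities) an entire function $F$ of order one, in the sense that for every $\varepsilon>0$ one has $\ln|F(\omega)|<|\omega|^{1+\varepsilon}$ for all large enough $|\omega|$; its zeroes are all simple and are located at the points $\omega_n^+$ and $-\omega_n^+$. Let $\pi_N^{\pm}(\omega)=\prod_{|\omega_n^{\pm}|<R_N}\bigl(1-\omega/\omega_n^{\pm}\bigr)$. Then the limit $$S(\omega)=\lim_{N\to\infty}\pi_N^+(\omega)\,\pi_N^-(-\omega)$$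 exists locally uniformly on $\mathbb{C}$ and is an entire function, which vanishes exactly at the points $\omega_n^+$ and $-\omega_n^-$. Moreover $G'(0)=\tfrac{i}{2}\mu\beta$ with a real constant $\mu\ne 0$, which is positive if $\omega\rho(\omega)\ge 0$ for all real $\omega$, and for all $\omega\in\mathbb{C}$ $$S(\omega)-S(-\omega)=2i\lambda\sinh\frac{\beta\omega}{2},\qquad \lambda=-\frac{\mu}{G(0)},$$ where $\lambda$ is a real constant independent of $\omega$. -/

import Mathlib

open Filter Topology

/-- `G` has a pole at `z`. -/
def IsPoleOf (G : ℂ → ℂ) (z : ℂ) : Prop := meromorphicOrderAt G z < 0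

/-- `G` has a zero at `z`. -/
def IsZeroOf (G : ℂ → ℂ) (z : ℂ) : Prop := 0 < meromorphicOrderAt G z

/-- Meromorphic retarded correlator (at fixed momentum) of a Hermitian operator in a stable
theory, with simple poles and simple zeroes, none of the zeroes being at the origin.
Normal form only fixes the representative of the meromorphic function: it has no removable
singularities, and takes the conventional value `0` at its poles. -/
structure IsRetardedCorrelator (G : ℂ → ℂ) : Prop where
  meromorphic : MeromorphicNFOn G Set.univ
  analytic_upper : ∀ ω : ℂ, 0 ≤ ω.im → AnalyticAt ℂ G ω
  hermitian : ∀ ω : ℂ, (starRingEnd ℂ) (G ω) = G (-(starRingEnd ℂ) ω)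
  simple_poles : ∀ ω : ℂ, -1 ≤ meromorphicOrderAt G ω
  simple_zeroes : ∀ ω : ℂ, meromorphicOrderAt G ω ≤ 1
  ne_zero_at_zero : G 0 ≠ 0

/-- Spectral density `ρ(ω) = (G(ω) - G(-ω)) / 2i`. -/
noncomputable def spectralDensity (G : ℂ → ℂ) (ω : ℂ) : ℂ :=
  (G ω - G (-ω)) / (2 * Complex.I)

/-- Power-law asymptotics of `G` along the circles of radius `R N`, where `R` is an increasing
unbounded sequence of positive radii: `∂ log G = G' / G` is finite on these circles (so that they
meet no pole and no zero of `G`) and is bounded there by `C / R N`. -/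
structure HasPowerLawBound (G : ℂ → ℂ) (R : ℕ → ℝ) (C : ℝ) : Prop where
  pos : ∀ N, 0 < R N
  strictMono : StrictMono R
  tendsto : Tendsto R atTop atTop
  regular : ∀ (N : ℕ) (ω : ℂ), ‖ω‖ = R N → AnalyticAt ℂ G ω ∧ G ω ≠ 0
  bound : ∀ (N : ℕ) (ω : ℂ), ‖ω‖ = R N → ‖logDeriv G ω‖ ≤ C / R N

/-- `F` is entire and, for every `ε > 0`, `log |F(ω)| < |ω| ^ (1 + ε)` for large `|ω|`. -/
def IsEntireOfOrderOne (F : ℂ → ℂ) : Prop :=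
  Differentiable ℂ F ∧
    ∀ ε : ℝ, 0 < ε → ∀ᶠ ω in Bornology.cobounded ℂ, Real.log ‖F ω‖ < ‖ω‖ ^ (1 + ε)

/-- Thermal product hypothesis: `sinh (β ω / 2) / ρ(ω)` is (the restriction to the complement of
the poles of `ρ` of) an entire function `F` of order one, whose zeroes are simple and lie
at poles `p` of `G` or at their mirror images `-p`. -/
def ThermalProductHypothesis (G : ℂ → ℂ) (β : ℝ) : Prop :=
  ∃ F : ℂ → ℂ, IsEntireOfOrderOne F ∧
    (∀ ω : ℂ, ¬ IsPoleOf G ω → ¬ IsPoleOf G (-ω) →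
      F ω * spectralDensity G ω = Complex.sinh (β * ω / 2)) ∧
    (∀ ω : ℂ, F ω = 0 → (IsPoleOf G ω ∨ IsPoleOf G (-ω)) ∧ deriv F ω ≠ 0)

/-- Partial product over the (simple) poles of `G` of modulus less than `r`. -/
noncomputable def polePartialProduct (G : ℂ → ℂ) (r : ℝ) (ω : ℂ) : ℂ :=
  ∏ᶠ z ∈ {z : ℂ | IsPoleOf G z ∧ ‖z‖ < r}, (1 - ω / z)

/-- Partial product over the (simple) zeroes of `G` of modulus less than `r`. -/
noncomputable def zeroPartialProduct (G : ℂ → ℂ) (r : ℝ) (ω : ℂ) : ℂ :=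
  ∏ᶠ z ∈ {z : ℂ | IsZeroOf G z ∧ ‖z‖ < r}, (1 - ω / z)

/-!
The limit of the partial products is identified in closed form: `S(ω) = F(ω) G(-ω) / (F(0) G(0))`,
where `F` is the entire function `sinh(βω/2) / ρ(ω)`. Given this, everything else is read off.

* `F(ω) G(-ω)` is entire with the right zeroes, because all poles of `G` lie in the open lower
  half-plane: the simple poles of `G(-ω)` cancel the zeroes `-ωₙ⁺` of `F`
  (`exists_entire_mul_reflection`).
* `F` is even, hence `S(ω) - S(-ω)` is proportional to `F(ω) (G(-ω) - G(ω)) = -2i F(ω) ρ(ω)`,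
  a multiple of `sinh(βω/2)`.
* Differentiating `F ρ = sinh(βω/2)` at the origin gives `F(0) G'(0) = iβ/2`, so `μ = 1 / F(0)`,
  which is real because `G` is real on the imaginary axis.

The convergence rests on two product expansions.

* `F(ω) = F(0) lim π⁺(ω) π⁺(-ω)`. The quotient `Q` of `F` by the partial product has no zeroes for
  `|ω| < R_N`, and by the maximum principle on `|ω| = 2 R_N` it is bounded there by
  `exp ((2 R_N)^(3/2))`. By Borel–Carathéodory its logarithm is `O(R_N^(3/2))` on a smaller disc;
  since `Q` is even, the logarithm vanishes to second order at `0`, and the Schwarz lemma improves the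
  bound to `O(R_N^(-1/2))` on compact sets (`exists_small_log_of_deriv_eq_zero`). This replaces
  Hadamard factorisation.
* `G(ω) = G(0) lim π⁻(ω) / π⁺(ω)`. The function `g = G π⁺ / π⁻` has no zeroes or poles for
  `|ω| ≤ R_N`. In the Cauchy formula for `g' / g` on `|ω| = R_N` the terms from `π⁺` and `π⁻` integrate
  to zero, so `|g' / g| ≤ C / (R_N - |ω|)` (`norm_logDeriv_le_of_removed_divisor`).

Multiplying the two, `S` differs from the `N`-th partial product by a factor `exp l` with `l → 0`
locally uniformly (`eventually_partialProduct_mul_exp`).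
-/

/-! ### Orders of meromorphic functions -/

theorem meromorphicOrderAt_comp_neg (f : ℂ → ℂ) (z : ℂ) :
    meromorphicOrderAt (fun ω => f (-ω)) z = meromorphicOrderAt f (-z) := by
  have h := meromorphicOrderAt_comp_of_deriv_ne_zero (f := f) (g := fun ω : ℂ => -ω) (x := z)
    (by fun_prop) (by simp)
  simpa [Function.comp_def] using h

theorem MeromorphicAt.comp_neg {f : ℂ → ℂ} {z : ℂ} (hf : MeromorphicAt f (-z)) :
    MeromorphicAt (fun ω => f (-ω)) z :=
  MeromorphicAt.comp_analyticAt (g := fun ω : ℂ => -ω) hf (by fun_prop)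

theorem tendsto_neg_nhdsNE_neg (z : ℂ) : Tendsto (fun w : ℂ => -w) (𝓝[≠] z) (𝓝[≠] (-z)) :=
  tendsto_nhdsWithin_iff.2 ⟨(continuous_neg.tendsto z).mono_left nhdsWithin_le_nhds, by
    filter_upwards [self_mem_nhdsWithin] with w hw using by simpa using hw⟩

/-- Every meromorphic function has a representative without removable singularities: analytic
wherever the order is nonnegative, and nonzero exactly where the order is zero (at a pole it takes
the conventional value `0`). -/
theorem exists_regularization {f : ℂ → ℂ} (hf : ∀ z, MeromorphicAt f z) :
    ∃ g : ℂ → ℂ, ∀ z, g =ᶠ[𝓝[≠] z] f ∧ (0 ≤ meromorphicOrderAt f z → AnalyticAt ℂ g z) ∧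
      (g z ≠ 0 ↔ meromorphicOrderAt f z = 0) := by
  have hf' : MeromorphicOn f Set.univ := fun z _ => hf z
  have hn := meromorphicNFOn_toMeromorphicNFOn f Set.univ
  refine ⟨toMeromorphicNFOn f Set.univ, fun z => ⟨?_, ?_, ?_⟩⟩
  · exact hf'.toMeromorphicNFOn_eq_self_on_nhdsNE (Set.mem_univ z)
  · intro h
    rw [← meromorphicOrderAt_toMeromorphicNFOn hf' (Set.mem_univ z)] at h
    exact (hn (Set.mem_univ z)).meromorphicOrderAt_nonneg_iff_analyticAt.1 h
  · rw [← meromorphicOrderAt_toMeromorphicNFOn hf' (Set.mem_univ z)]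
    exact (hn (Set.mem_univ z)).meromorphicOrderAt_eq_zero_iff.symm

theorem ContinuousAt.eq_of_eventuallyEq_nhdsNE {f g : ℂ → ℂ} {z : ℂ} (hf : ContinuousAt f z)
    (hg : ContinuousAt g z) (h : f =ᶠ[𝓝[≠] z] g) : f z = g z :=
  ((ContinuousAt.eventuallyEq_nhds_iff_eventuallyEq_nhdsNE hf hg).1 h).eq_of_nhds

/-! ### Products of linear factors -/

/-- The polynomial with simple zeroes at the points of `A`, normalised to be `1` at the origin. It
is meant for `0 ∉ A`: a point `0 ∈ A` would contribute the factor `1 - ω / 0 = 1`. -/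
noncomputable def linearProduct (A : Finset ℂ) (ω : ℂ) : ℂ := ∏ z ∈ A, (1 - ω / z)

theorem differentiable_linearProduct (A : Finset ℂ) : Differentiable ℂ (linearProduct A) := by
  unfold linearProduct
  fun_prop

theorem analyticAt_linearProduct (A : Finset ℂ) (z : ℂ) : AnalyticAt ℂ (linearProduct A) z :=
  (differentiable_linearProduct A).analyticAt z

@[simp] theorem linearProduct_zero (A : Finset ℂ) : linearProduct A 0 = 1 := by
  simp [linearProduct]

theorem one_sub_div_eq_zero_iff {w z : ℂ} (hz : z ≠ 0) : 1 - w / z = 0 ↔ w = z := by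
  rw [sub_eq_zero, eq_comm, div_eq_one_iff_eq hz]

theorem linearProduct_ne_zero {A : Finset ℂ} (hA : (0 : ℂ) ∉ A) {z : ℂ} (hz : z ∉ A) :
    linearProduct A z ≠ 0 := by
  refine Finset.prod_ne_zero_iff.2 fun a ha h => ?_
  rw [one_sub_div_eq_zero_iff (by rintro rfl; exact hA ha)] at h
  exact hz (h ▸ ha)

theorem meromorphicOrderAt_linearProduct_of_notMem {A : Finset ℂ} (hA : (0 : ℂ) ∉ A) {z : ℂ}
    (hz : z ∉ A) : meromorphicOrderAt (linearProduct A) z = 0 :=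
  (analyticAt_linearProduct A z).meromorphicNFAt.meromorphicOrderAt_eq_zero_iff.2
    (linearProduct_ne_zero hA hz)

theorem meromorphicOrderAt_linearProduct_of_mem {A : Finset ℂ} (hA : (0 : ℂ) ∉ A) {z : ℂ}
    (hz : z ∈ A) : meromorphicOrderAt (linearProduct A) z = 1 := by
  classical
  have hz0 : z ≠ 0 := by rintro rfl; exact hA hz
  have h : linearProduct A =
      (fun ω => -z⁻¹ * linearProduct (A.erase z) ω) * (fun ω => ω - z) := by
    funext ω
    rw [linearProduct, ← Finset.mul_prod_erase A _ hz]
    simp only [Pi.mul_apply, linearProduct]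
    field_simp
    ring
  rw [h, meromorphicOrderAt_mul_of_ne_zero]
  · exact meromorphicOrderAt_id_sub_const
  · exact analyticAt_const.mul (analyticAt_linearProduct _ z)
  · exact mul_ne_zero (by simpa using hz0)
      (linearProduct_ne_zero (by simp [hA]) (by simp))

theorem linearProduct_eventually_ne_zero {A : Finset ℂ} (hA : (0 : ℂ) ∉ A) (z : ℂ) :
    ∀ᶠ w in 𝓝[≠] z, linearProduct A w ≠ 0 := by
  have : ∀ᶠ w in 𝓝[≠] z, w ∉ A := by
    have hfin : ((A : Set ℂ) \ {z}).Finite := A.finite_toSet.subset Set.sdiff_subset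
    have h := hfin.isClosed.isOpen_compl.mem_nhds
      (show z ∈ ((A : Set ℂ) \ {z})ᶜ by simp)
    filter_upwards [mem_nhdsWithin_of_mem_nhds h, self_mem_nhdsWithin] with w hw hw' hwA
    exact hw ⟨hwA, hw'⟩
  filter_upwards [this] with w hw using linearProduct_ne_zero hA hw

theorem logDeriv_linearProduct {A : Finset ℂ} (hA : (0 : ℂ) ∉ A) {z : ℂ} (hz : z ∉ A) :
    logDeriv (linearProduct A) z = ∑ a ∈ A, (z - a)⁻¹ := by
  have hne : ∀ a ∈ A, 1 - z / a ≠ 0 := fun a ha h => by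
    rw [one_sub_div_eq_zero_iff (by rintro rfl; exact hA ha)] at h
    exact hz (h ▸ ha)
  have h := logDeriv_prod (s := A) (f := fun a ω => 1 - ω / a) (x := z) hne
    (fun a _ => by fun_prop)
  rw [show linearProduct A = fun ω => ∏ a ∈ A, (1 - ω / a) from rfl, h]
  refine Finset.sum_congr rfl fun a ha => ?_
  have ha0 : a ≠ 0 := by rintro rfl; exact hA ha
  have hza : z - a ≠ 0 := sub_ne_zero.2 fun h => hz (h ▸ ha)
  have hd : HasDerivAt (fun ω : ℂ => 1 - ω / a) (-(1 / a)) z :=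
    ((hasDerivAt_id z).div_const a).const_sub 1
  have := hne a ha
  rw [logDeriv_apply, hd.deriv]
  have h1 : a - z ≠ 0 := by rw [← neg_sub]; exact neg_ne_zero.2 hza
  field_simp
  ring

/-- A normalised product of linear factors with zeroes of modulus less than `r` has modulus at least
one outside the disc of radius `2 r`. -/
theorem one_le_norm_linearProduct {A : Finset ℂ} {r : ℝ} (hA : ∀ a ∈ A, a ≠ 0 ∧ ‖a‖ < r) {z : ℂ}
    (hz : 2 * r ≤ ‖z‖) : 1 ≤ ‖linearProduct A z‖ := by
  rw [linearProduct, norm_prod]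
  refine Finset.one_le_prod fun a ha => ?_
  obtain ⟨ha0, har⟩ := hA a ha
  have h0 : 0 < ‖a‖ := norm_pos_iff.2 ha0
  have h1 : 2 ≤ ‖z / a‖ := by
    rw [norm_div, le_div_iff₀ h0]; linarith
  have h2 := norm_sub_norm_le (z / a) 1
  rw [norm_one, norm_sub_rev] at h2
  linarith

/-! ### Logarithms of nonvanishing functions on a disc -/

theorem exists_log_on_ball {f : ℂ → ℂ} {r : ℝ} (hr : 0 < r)
    (hf : DifferentiableOn ℂ f (Metric.ball 0 r)) (h0 : ∀ z ∈ Metric.ball (0 : ℂ) r, f z ≠ 0) :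
    ∃ l : ℂ → ℂ, l 0 = 0 ∧ ∀ z ∈ Metric.ball (0 : ℂ) r,
      HasDerivAt l (logDeriv f z) z ∧ f z = f 0 * Complex.exp (l z) := by
  have hld : DifferentiableOn ℂ (logDeriv f) (Metric.ball 0 r) :=
    (hf.deriv Metric.isOpen_ball).div hf h0
  obtain ⟨l, hl0, hl⟩ := hld.isExactOn_ball.with_val_at 0 0
  have hmem : (0 : ℂ) ∈ Metric.ball (0 : ℂ) r := Metric.mem_ball_self hr
  refine ⟨l, hl0, fun z hz => ⟨hl z hz, ?_⟩⟩
  -- the derivative of `f * exp (-l)` vanishes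
  have hd : ∀ w ∈ Metric.ball (0 : ℂ) r,
      HasDerivAt (fun w => f w * Complex.exp (-l w)) 0 w := by
    intro w hw
    have h1 := (hf.differentiableAt (Metric.isOpen_ball.mem_nhds hw)).hasDerivAt
    have h2 := (hl w hw).neg.cexp
    refine (h1.mul h2).congr_deriv ?_
    have := h0 w hw
    simp only [Pi.neg_apply, logDeriv_apply]
    field_simp
    ring
  have hc := (convex_ball (0 : ℂ) r).is_const_of_fderivWithin_eq_zero (𝕜 := ℂ)
    (f := fun w => f w * Complex.exp (-l w))
    (fun w hw => (hd w hw).differentiableAt.differentiableWithinAt)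
    (fun w hw => by
      rw [fderivWithin_of_isOpen Metric.isOpen_ball hw]
      ext
      simpa using (hd w hw).deriv) hz hmem
  simp only [hl0, neg_zero, Complex.exp_zero, mul_one] at hc
  rw [← hc, mul_assoc, ← Complex.exp_add]
  simp

/-- A nonvanishing function of the disc of radius `r`, stationary at the origin and bounded by
`exp M` times its value there, has a logarithm of size `O(M |z|² / r²)`: Borel–Carathéodory on the
half disc followed by the Schwarz lemma at second order. -/
theorem exists_small_log_of_deriv_eq_zero {f : ℂ → ℂ} {r M : ℝ} (hr : 0 < r) (hM : 0 < M)
    (hf : DifferentiableOn ℂ f (Metric.ball 0 r)) (h0 : ∀ z ∈ Metric.ball (0 : ℂ) r, f z ≠ 0)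
    (hd : deriv f 0 = 0) (hb : ∀ z ∈ Metric.ball (0 : ℂ) r, ‖f z‖ ≤ ‖f 0‖ * Real.exp M) :
    ∀ z, ‖z‖ < r / 2 → ∃ l : ℂ, ‖l‖ ≤ 8 * M * ‖z‖ ^ 2 / r ^ 2 ∧ f z = f 0 * Complex.exp l := by
  intro z hz
  obtain ⟨l, hl0, hl⟩ := exists_log_on_ball hr hf h0
  have hmem : (0 : ℂ) ∈ Metric.ball (0 : ℂ) r := Metric.mem_ball_self hr
  have hf0 : 0 < ‖f 0‖ := norm_pos_iff.2 (h0 0 hmem)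
  have hld : DifferentiableOn ℂ l (Metric.ball 0 r) :=
    fun w hw => (hl w hw).1.differentiableAt.differentiableWithinAt
  have hre : Set.MapsTo l (Metric.ball 0 r) {w | w.re ≤ M} := by
    intro w hw
    have h1 := hb w hw
    rw [(hl w hw).2, norm_mul, Complex.norm_exp] at h1
    exact Real.exp_le_exp.1 (le_of_mul_le_mul_left h1 hf0)
  have hsub : Metric.ball (0 : ℂ) (r / 2) ⊆ Metric.ball 0 r := Metric.ball_subset_ball (by linarith)
  have hmaps : Set.MapsTo l (Metric.ball 0 (r / 2)) (Metric.closedBall (l 0) (2 * M)) := by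
    intro w hw
    have h1 := Complex.borelCaratheodory_zero hM hld hre hr (hsub hw) hl0
    rw [mem_ball_zero_iff] at hw
    rw [hl0, mem_closedBall_zero_iff]
    refine h1.trans ?_
    rw [div_le_iff₀ (by linarith)]
    nlinarith
  have hlittle : (fun w => l w - l 0) =o[𝓝 0] (fun w : ℂ => ‖w - 0‖ ^ 1) := by
    have h1 := (hl 0 hmem).1
    rw [logDeriv_apply, hd, zero_div, hasDerivAt_iff_isLittleO] at h1
    simpa using h1.norm_right
  have hz' : z ∈ Metric.ball (0 : ℂ) (r / 2) := by simpa using hz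
  have h2 := Complex.dist_le_mul_div_pow_of_mapsTo_ball_of_isLittleO (n := 1)
    (hld.mono hsub) hmaps hlittle hz'
  refine ⟨l z, ?_, (hl z (hsub hz')).2⟩
  rw [hl0, dist_zero_right, dist_zero_right] at h2
  have := hr.ne'
  refine h2.trans (le_of_eq ?_)
  simp only [Nat.reduceAdd, div_pow]
  field_simp
  ring

theorem exists_small_log_of_logDeriv_bound {f : ℂ → ℂ} {r s K : ℝ} (hs : 0 ≤ s) (hsr : s < r)
    (hf : DifferentiableOn ℂ f (Metric.ball 0 r)) (h0 : ∀ z ∈ Metric.ball (0 : ℂ) r, f z ≠ 0)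
    (hb : ∀ z, ‖z‖ ≤ s → ‖logDeriv f z‖ ≤ K) :
    ∀ z, ‖z‖ ≤ s → ∃ l : ℂ, ‖l‖ ≤ K * ‖z‖ ∧ f z = f 0 * Complex.exp l := by
  intro z hz
  obtain ⟨l, hl0, hl⟩ := exists_log_on_ball (hs.trans_lt hsr) hf h0
  have hsub : Metric.closedBall (0 : ℂ) s ⊆ Metric.ball 0 r := Metric.closedBall_subset_ball hsr
  have hz' : z ∈ Metric.closedBall (0 : ℂ) s := by simpa using hz
  refine ⟨l z, ?_, (hl z (hsub hz')).2⟩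
  have := (convex_closedBall (0 : ℂ) s).norm_image_sub_le_of_norm_hasDerivWithin_le
    (fun w hw => (hl w (hsub hw)).1.hasDerivWithinAt) (fun w hw => hb w (by simpa using hw))
    (Metric.mem_closedBall_self hs) hz'
  simpa [hl0] using this

/-- Functions that agree with a continuous function up to factors `exp l`, with `l` uniformly small
on discs, converge to it locally uniformly. -/
theorem tendstoLocallyUniformly_of_eq_mul_exp {s : ℕ → ℂ → ℂ} {S : ℂ → ℂ} (hS : Continuous S)
    (h : ∀ r ε : ℝ, 0 < r → 0 < ε → ∀ᶠ N in atTop, ∀ z, ‖z‖ ≤ r →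
      ∃ l : ℂ, ‖l‖ ≤ ε ∧ S z = s N z * Complex.exp l) :
    TendstoLocallyUniformly s S atTop := by
  rw [Metric.tendstoLocallyUniformly_iff]
  intro ε hε x
  refine ⟨Metric.closedBall 0 (‖x‖ + 1), ?_, ?_⟩
  · refine Metric.closedBall_mem_nhds_of_mem ?_
    simp
  obtain ⟨K, hK⟩ := (isCompact_closedBall (0 : ℂ) (‖x‖ + 1)).exists_bound_of_continuousOn
    hS.continuousOn
  have hK0 : 0 ≤ K := (norm_nonneg _).trans (hK 0 (by simp; positivity))
  filter_upwards [h (‖x‖ + 1) (min 1 (ε / (4 * (K + 1)))) (by positivity) (by positivity)]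
    with N hN y hy
  obtain ⟨l, hl, hSy⟩ := hN y (by simpa using hy)
  have hs : s N y = S y * Complex.exp (-l) := by
    rw [hSy, mul_assoc, ← Complex.exp_add]; simp
  have h1 := Complex.norm_exp_sub_one_le (x := -l) (by simpa using hl.trans (min_le_left _ _))
  rw [norm_neg] at h1
  have h2 := hl.trans (min_le_right _ _)
  rw [dist_comm, dist_eq_norm, hs, show S y * Complex.exp (-l) - S y
    = S y * (Complex.exp (-l) - 1) by ring, norm_mul]
  calc ‖S y‖ * ‖Complex.exp (-l) - 1‖ ≤ K * (2 * (ε / (4 * (K + 1)))) := by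
        gcongr
        · exact hK y hy
        · linarith
    _ < ε := by
        rw [show K * (2 * (ε / (4 * (K + 1)))) = (ε * (K / (K + 1))) / 2 by field_simp; ring]
        have : K / (K + 1) ≤ 1 := (div_le_one (by positivity)).2 (by linarith)
        nlinarith

/-! ### A Cauchy estimate for logarithmic derivatives -/

theorem circleIntegral_inv_mul_inv_eq_zero {r : ℝ} {a w : ℂ} (ha : ‖a‖ < r) (hw : ‖w‖ < r) :
    (∮ z in C(0, r), (z - w)⁻¹ * (z - a)⁻¹) = 0 := by
  have hr : 0 < r := (norm_nonneg a).trans_lt ha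
  have hne : ∀ {b z : ℂ}, ‖b‖ < r → z ∈ Metric.sphere (0 : ℂ) r → z - b ≠ 0 := by
    intro b z hb hz h
    rw [sub_eq_zero] at h
    rw [mem_sphere_zero_iff_norm, h] at hz
    exact hb.ne hz
  rcases eq_or_ne a w with rfl | haw
  · have h := circleIntegral.integral_sub_zpow_of_ne (n := -2) (by norm_num) 0 a r
    refine Eq.trans ?_ h
    refine circleIntegral.integral_congr hr.le fun z hz => ?_
    have := hne ha hz
    simp only [zpow_neg]
    rw [← mul_inv, ← sq]
    norm_cast
  · have haw' : w - a ≠ 0 := sub_ne_zero.2 haw.symm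
    have hci : ∀ {b : ℂ}, ‖b‖ < r → CircleIntegrable (fun z => (z - b)⁻¹) 0 r := by
      intro b hb
      refine ContinuousOn.circleIntegrable hr.le ?_
      exact ContinuousOn.inv₀ (by fun_prop) fun z hz => hne hb hz
    have h : (∮ z in C(0, r), (z - w)⁻¹ * (z - a)⁻¹)
        = ∮ z in C(0, r), (w - a)⁻¹ • ((z - w)⁻¹ - (z - a)⁻¹) := by
      refine circleIntegral.integral_congr hr.le fun z hz => ?_
      have h1 := hne ha hz
      have h2 := hne hw hz
      simp only [smul_eq_mul]
      field_simp
      ring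
    rw [h, circleIntegral.integral_smul, circleIntegral.integral_sub (hci hw) (hci ha),
      circleIntegral.integral_sub_inv_of_mem_ball (by simpa using hw),
      circleIntegral.integral_sub_inv_of_mem_ball (by simpa using ha), sub_self, smul_zero]

/-- Let `H = G π_A / π_B` be the function obtained from `G` by removing its poles `A` and its zeroes
`B` in the disc of radius `r`. The logarithmic derivatives of `π_A` and `π_B` do not contribute
to the Cauchy integral over the circle, so `H' / H` is controlled by the values of `G' / G` there. -/
theorem norm_logDeriv_le_of_removed_divisor {G H : ℂ → ℂ} {A B : Finset ℂ} {r K : ℝ} (hr : 0 < r)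
    (hA0 : (0 : ℂ) ∉ A) (hB0 : (0 : ℂ) ∉ B) (hA : ∀ a ∈ A, ‖a‖ < r) (hB : ∀ b ∈ B, ‖b‖ < r)
    (hH : ∀ z, ‖z‖ ≤ r → AnalyticAt ℂ H z ∧ H z ≠ 0)
    (hG : ∀ z, ‖z‖ = r → AnalyticAt ℂ G z ∧ G z ≠ 0)
    (hGH : ∀ z, ‖z‖ = r → (fun ω => H ω * linearProduct B ω) =ᶠ[𝓝 z]
      fun ω => G ω * linearProduct A ω)
    (hK : ∀ z, ‖z‖ = r → ‖logDeriv G z‖ ≤ K) {w : ℂ} (hw : ‖w‖ < r) :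
    ‖logDeriv H w‖ ≤ r * (K / (r - ‖w‖)) := by
  have hne : ∀ {b z : ℂ}, ‖b‖ < r → z ∈ Metric.sphere (0 : ℂ) r → z - b ≠ 0 := by
    intro b z hb hz h
    rw [sub_eq_zero] at h
    rw [mem_sphere_zero_iff_norm, h] at hz
    exact hb.ne hz
  have hlog : ∀ z ∈ Metric.sphere (0 : ℂ) r, logDeriv H z
      = logDeriv G z + (∑ a ∈ A, (z - a)⁻¹ - ∑ b ∈ B, (z - b)⁻¹) := by
    intro z hz
    rw [mem_sphere_zero_iff_norm] at hz
    have hzA : z ∉ A := fun h => (hA z h).ne hz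
    have hzB : z ∉ B := fun h => (hB z h).ne hz
    have h1 := logDeriv_congr_nhds (hGH z hz)
    have h2 := logDeriv_mul z (hH z hz.le).2 (linearProduct_ne_zero hB0 hzB)
      (hH z hz.le).1.differentiableAt (differentiable_linearProduct B z)
    have h3 := logDeriv_mul z (hG z hz).2 (linearProduct_ne_zero hA0 hzA)
      (hG z hz).1.differentiableAt (differentiable_linearProduct A z)
    have h4 := h1.eq_of_nhds
    rw [h2, h3, logDeriv_linearProduct hA0 hzA, logDeriv_linearProduct hB0 hzB] at h4
    linear_combination h4
  have hd : DifferentiableOn ℂ (logDeriv H) (Metric.closedBall 0 r) := by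
    intro z hz
    have h := hH z (by simpa using hz)
    exact (h.1.deriv.div h.1 h.2).differentiableAt.differentiableWithinAt
  have hcauchy := hd.circleIntegral_sub_inv_smul (w := w) (by simpa using hw)
  have hcG : ContinuousOn (logDeriv G) (Metric.sphere 0 r) := by
    intro z hz
    have h := hG z (by simpa using hz)
    exact (h.1.deriv.div h.1 h.2).continuousAt.continuousWithinAt
  have hcinv : ∀ {b : ℂ}, ‖b‖ < r → ContinuousOn (fun z => (z - b)⁻¹) (Metric.sphere 0 r) :=
    fun hb => ContinuousOn.inv₀ (by fun_prop) fun z hz => hne hb hz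
  have hcw := hcinv hw
  have hsum : ∀ D : Finset ℂ, (∀ d ∈ D, ‖d‖ < r) →
      CircleIntegrable (fun z => ∑ d ∈ D, (z - w)⁻¹ * (z - d)⁻¹) 0 r ∧
      (∮ z in C(0, r), ∑ d ∈ D, (z - w)⁻¹ * (z - d)⁻¹) = 0 := by
    intro D hD
    have hi : ∀ d ∈ D, CircleIntegrable (fun z => (z - w)⁻¹ * (z - d)⁻¹) 0 r :=
      fun d hd => (hcw.mul (hcinv (hD d hd))).circleIntegrable hr.le
    constructor
    · exact (continuousOn_finsetSum D fun d hd => hcw.mul (hcinv (hD d hd))).circleIntegrable hr.le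
    · rw [circleIntegral.integral_fun_sum hi]
      exact Finset.sum_eq_zero fun d hd => circleIntegral_inv_mul_inv_eq_zero (hD d hd) hw
  have hint : (∮ z in C(0, r), (z - w)⁻¹ • logDeriv H z)
      = ∮ z in C(0, r), (z - w)⁻¹ * logDeriv G z := by
    have h1 : (∮ z in C(0, r), (z - w)⁻¹ • logDeriv H z)
        = ∮ z in C(0, r), ((z - w)⁻¹ * logDeriv G z +
          (∑ a ∈ A, (z - w)⁻¹ * (z - a)⁻¹ - ∑ b ∈ B, (z - w)⁻¹ * (z - b)⁻¹)) := by
      refine circleIntegral.integral_congr hr.le fun z hz => ?_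
      simp only [smul_eq_mul]
      rw [hlog z hz, ← Finset.mul_sum, ← Finset.mul_sum]
      ring
    have hi : CircleIntegrable (fun z => (z - w)⁻¹ * logDeriv G z) 0 r :=
      (hcw.mul hcG).circleIntegrable hr.le
    have hs : CircleIntegrable (fun z => ∑ a ∈ A, (z - w)⁻¹ * (z - a)⁻¹ -
        ∑ b ∈ B, (z - w)⁻¹ * (z - b)⁻¹) 0 r := (hsum A hA).1.sub (hsum B hB).1
    rw [h1, circleIntegral.integral_add hi hs,
      circleIntegral.integral_sub (hsum A hA).1 (hsum B hB).1, (hsum A hA).2, (hsum B hB).2,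
      sub_zero, add_zero]
  have hbound : ‖∮ z in C(0, r), (z - w)⁻¹ * logDeriv G z‖
      ≤ 2 * Real.pi * r * (K / (r - ‖w‖)) := by
    refine circleIntegral.norm_integral_le_of_norm_le_const hr.le fun z hz => ?_
    rw [mem_sphere_zero_iff_norm] at hz
    have h1 : r - ‖w‖ ≤ ‖z - w‖ := by
      have := norm_sub_norm_le z w
      rwa [hz] at this
    have h2 : 0 < r - ‖w‖ := by linarith
    rw [norm_mul, norm_inv, div_eq_inv_mul]
    have := hK z hz
    gcongr
  rw [← hint, hcauchy, norm_smul] at hbound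
  have hpi : ‖(2 * (Real.pi : ℂ) * Complex.I)‖ = 2 * Real.pi := by
    simp [abs_of_pos Real.pi_pos]
  rw [hpi, mul_assoc (2 * Real.pi) r] at hbound
  exact le_of_mul_le_mul_left hbound (by positivity)

/-! ### Poles and zeroes of a retarded correlator -/

namespace IsRetardedCorrelator

variable {G : ℂ → ℂ}

theorem meromorphicNFAt (hG : IsRetardedCorrelator G) (z : ℂ) : MeromorphicNFAt G z :=
  hG.meromorphic (Set.mem_univ z)

theorem meromorphicAt (hG : IsRetardedCorrelator G) (z : ℂ) : MeromorphicAt G z :=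
  (hG.meromorphicNFAt z).meromorphicAt

theorem isPoleOf_iff (hG : IsRetardedCorrelator G) (z : ℂ) :
    IsPoleOf G z ↔ ¬ AnalyticAt ℂ G z := by
  rw [← (hG.meromorphicNFAt z).meromorphicOrderAt_nonneg_iff_analyticAt, not_le, IsPoleOf]

theorem not_isPoleOf_neg (hG : IsRetardedCorrelator G) {z : ℂ} (hz : IsPoleOf G z) :
    ¬ IsPoleOf G (-z) := by
  rw [hG.isPoleOf_iff] at hz ⊢
  rw [not_not]
  refine hG.analytic_upper _ ?_
  by_contra! h
  refine hz (hG.analytic_upper _ ?_)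
  rw [Complex.neg_im] at h
  linarith

theorem not_isPoleOf_zero (hG : IsRetardedCorrelator G) : ¬ IsPoleOf G 0 := by
  rw [hG.isPoleOf_iff, not_not]
  exact hG.analytic_upper 0 (by simp)

theorem analyticAt_zero (hG : IsRetardedCorrelator G) : AnalyticAt ℂ G 0 :=
  hG.analytic_upper 0 (by simp)

theorem meromorphicOrderAt_of_isPoleOf (hG : IsRetardedCorrelator G) {z : ℂ}
    (hz : IsPoleOf G z) : meromorphicOrderAt G z = -1 := by
  have h1 := hG.simple_poles z
  unfold IsPoleOf at hz
  cases h : meromorphicOrderAt G z with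
  | top => rw [h] at hz; exact absurd hz (by decide)
  | coe n =>
    rw [h] at h1 hz
    change ((-1 : ℤ) : WithTop ℤ) ≤ n at h1
    change _ = ((-1 : ℤ) : WithTop ℤ)
    norm_cast at *
    omega

theorem meromorphicOrderAt_of_isZeroOf (hG : IsRetardedCorrelator G) {z : ℂ}
    (hz : IsZeroOf G z) : meromorphicOrderAt G z = 1 := by
  have h1 := hG.simple_zeroes z
  unfold IsZeroOf at hz
  cases h : meromorphicOrderAt G z with
  | top => rw [h] at h1; exact absurd h1 (by decide)
  | coe n =>
    rw [h] at h1 hz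
    norm_cast at *
    omega

theorem meromorphicOrderAt_eq_zero {z : ℂ}
    (hz : ¬ IsPoleOf G z) (hz' : ¬ IsZeroOf G z) : meromorphicOrderAt G z = 0 :=
  le_antisymm (not_lt.1 hz') (not_lt.1 hz)

theorem eventually_not_isPoleOf (hG : IsRetardedCorrelator G) (z : ℂ) :
    ∀ᶠ w in 𝓝[≠] z, ¬ IsPoleOf G w := by
  filter_upwards [(hG.meromorphicAt z).eventually_analyticAt] with w hw
  rw [hG.isPoleOf_iff, not_not]
  exact hw

theorem eventually_not_isPoleOf_neg (hG : IsRetardedCorrelator G) (z : ℂ) :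
    ∀ᶠ w in 𝓝[≠] z, ¬ IsPoleOf G (-w) :=
  (tendsto_neg_nhdsNE_neg z).eventually (hG.eventually_not_isPoleOf (-z))

theorem eventually_ne_zero (hG : IsRetardedCorrelator G) (z : ℂ) :
    ∀ᶠ w in 𝓝[≠] z, G w ≠ 0 := by
  refine (meromorphicOrderAt_ne_top_iff_eventually_ne_zero (hG.meromorphicAt z)).1 fun h => ?_
  have h1 := hG.simple_zeroes z
  rw [h] at h1
  exact absurd h1 (by decide)

theorem finite_setOf_meromorphicOrderAt_ne_zero (hG : IsRetardedCorrelator G) (r : ℝ) :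
    {z : ℂ | meromorphicOrderAt G z ≠ 0 ∧ ‖z‖ < r}.Finite := by
  by_contra hinf
  obtain ⟨z, -, hz⟩ := Set.Infinite.exists_accPt_of_subset_isCompact hinf
    (isCompact_closedBall (0 : ℂ) r) (fun z hz => by simpa using hz.2.le)
  rw [accPt_iff_frequently_nhdsNE] at hz
  refine hz ?_
  filter_upwards [hG.eventually_ne_zero z] with w hw h
  exact h.1 ((hG.meromorphicNFAt w).meromorphicOrderAt_eq_zero_iff.2 hw)

theorem exists_polePartialProduct_eq (hG : IsRetardedCorrelator G) (r : ℝ) :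
    ∃ A : Finset ℂ, (∀ z, z ∈ A ↔ IsPoleOf G z ∧ ‖z‖ < r) ∧
      polePartialProduct G r = linearProduct A := by
  have hfin : {z : ℂ | IsPoleOf G z ∧ ‖z‖ < r}.Finite :=
    (hG.finite_setOf_meromorphicOrderAt_ne_zero r).subset fun z hz => ⟨hz.1.ne, hz.2⟩
  refine ⟨hfin.toFinset, fun z => by simp, ?_⟩
  funext ω
  rw [polePartialProduct, linearProduct, finprod_mem_eq_finite_toFinset_prod _ hfin]

theorem exists_zeroPartialProduct_eq (hG : IsRetardedCorrelator G) (r : ℝ) :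
    ∃ B : Finset ℂ, (∀ z, z ∈ B ↔ IsZeroOf G z ∧ ‖z‖ < r) ∧
      zeroPartialProduct G r = linearProduct B := by
  have hfin : {z : ℂ | IsZeroOf G z ∧ ‖z‖ < r}.Finite :=
    (hG.finite_setOf_meromorphicOrderAt_ne_zero r).subset fun z hz => ⟨hz.1.ne', hz.2⟩
  refine ⟨hfin.toFinset, fun z => by simp, ?_⟩
  funext ω
  rw [zeroPartialProduct, linearProduct, finprod_mem_eq_finite_toFinset_prod _ hfin]

theorem not_isZeroOf_zero (hG : IsRetardedCorrelator G) : ¬ IsZeroOf G 0 := fun h =>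
  h.ne' ((hG.meromorphicNFAt 0).meromorphicOrderAt_eq_zero_iff.2 hG.ne_zero_at_zero)

/-- Hermiticity forces `G` to be real on the imaginary axis, so `G'(0)` is purely imaginary. -/
theorem re_deriv_zero (hG : IsRetardedCorrelator G) : (deriv G 0).re = 0 := by
  have h1 := hG.analyticAt_zero.differentiableAt.hasDerivAt
  have h2 := h1.conj_conj
  have h3 : (starRingEnd ℂ ∘ G ∘ starRingEnd ℂ) = fun ω => G (-ω) := by
    funext ω
    simp [Function.comp_def, hG.hermitian]
  rw [h3, map_zero] at h2
  have h4 : deriv (fun ω => G (-ω)) 0 = -deriv G 0 := by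
    rw [deriv_comp_neg, neg_zero]
  rw [h2.deriv] at h4
  have := congrArg Complex.re h4
  simp only [Complex.conj_re, Complex.neg_re] at this
  linarith

theorem im_apply_zero (hG : IsRetardedCorrelator G) : (G 0).im = 0 := by
  have h := hG.hermitian 0
  simp only [map_zero, neg_zero] at h
  exact Complex.conj_eq_iff_im.1 h

/-- The function `G π⁺ / π⁻` obtained by removing the poles and zeroes of modulus less than `R N`:
it has no zeroes in that disc, and its logarithmic derivative is small on compact sets. -/
theorem exists_removed_divisor (hG : IsRetardedCorrelator G) {R : ℕ → ℝ} {C : ℝ}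
    (hR : HasPowerLawBound G R C) (N : ℕ) {A B : Finset ℂ}
    (hA : ∀ z, z ∈ A ↔ IsPoleOf G z ∧ ‖z‖ < R N) (hB : ∀ z, z ∈ B ↔ IsZeroOf G z ∧ ‖z‖ < R N) :
    ∃ g : ℂ → ℂ, (∀ z, ‖z‖ ≤ R N → AnalyticAt ℂ g z ∧ g z ≠ 0) ∧ g 0 = G 0 ∧
      (∀ z, g =ᶠ[𝓝[≠] z] fun ω => G ω * linearProduct A ω / linearProduct B ω) ∧
      ∀ z, ‖z‖ < R N → ‖logDeriv g z‖ ≤ C / (R N - ‖z‖) := by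
  have hA0 : (0 : ℂ) ∉ A := fun h => hG.not_isPoleOf_zero ((hA 0).1 h).1
  have hB0 : (0 : ℂ) ∉ B := fun h => hG.not_isZeroOf_zero ((hB 0).1 h).1
  have hmA : ∀ z, MeromorphicAt (linearProduct A) z := fun z =>
    (analyticAt_linearProduct A z).meromorphicAt
  have hmB : ∀ z, MeromorphicAt (linearProduct B) z := fun z =>
    (analyticAt_linearProduct B z).meromorphicAt
  have hord : ∀ z, ‖z‖ ≤ R N →
      meromorphicOrderAt (G * linearProduct A / linearProduct B) z = 0 := by
    intro z hz
    rw [meromorphicOrderAt_div ((hG.meromorphicAt z).mul (hmA z)) (hmB z),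
      meromorphicOrderAt_mul (hG.meromorphicAt z) (hmA z)]
    rcases hz.lt_or_eq with hlt | heq
    · by_cases hp : IsPoleOf G z
      · have hzB : z ∉ B := fun h => lt_asymm hp ((hB z).1 h).1
        rw [hG.meromorphicOrderAt_of_isPoleOf hp,
          meromorphicOrderAt_linearProduct_of_mem hA0 ((hA z).2 ⟨hp, hlt⟩),
          meromorphicOrderAt_linearProduct_of_notMem hB0 hzB]
        rfl
      · have hzA : z ∉ A := fun h => hp ((hA z).1 h).1
        rw [meromorphicOrderAt_linearProduct_of_notMem hA0 hzA]
        by_cases hq : IsZeroOf G z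
        · rw [hG.meromorphicOrderAt_of_isZeroOf hq,
            meromorphicOrderAt_linearProduct_of_mem hB0 ((hB z).2 ⟨hq, hlt⟩)]
          rfl
        · have hzB : z ∉ B := fun h => hq ((hB z).1 h).1
          rw [meromorphicOrderAt_eq_zero hp hq,
            meromorphicOrderAt_linearProduct_of_notMem hB0 hzB]
          rfl
    · have hzA : z ∉ A := fun h => ((hA z).1 h).2.ne heq
      have hzB : z ∉ B := fun h => ((hB z).1 h).2.ne heq
      rw [meromorphicOrderAt_linearProduct_of_notMem hA0 hzA,
        meromorphicOrderAt_linearProduct_of_notMem hB0 hzB,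
        (hG.meromorphicNFAt z).meromorphicOrderAt_eq_zero_iff.2 (hR.regular N z heq).2]
      rfl
  obtain ⟨g, hg⟩ := exists_regularization
    (fun z => ((hG.meromorphicAt z).mul (hmA z)).div (hmB z))
  have hgreg : ∀ z, ‖z‖ ≤ R N → AnalyticAt ℂ g z ∧ g z ≠ 0 := fun z hz =>
    ⟨(hg z).2.1 (hord z hz).ge, (hg z).2.2.2 (hord z hz)⟩
  have hgeq : ∀ z, g =ᶠ[𝓝[≠] z] fun ω => G ω * linearProduct A ω / linearProduct B ω :=
    fun z => (hg z).1
  refine ⟨g, hgreg, ?_, hgeq, fun w hw => ?_⟩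
  · have h := ContinuousAt.eq_of_eventuallyEq_nhdsNE
      (hgreg 0 (by simpa using (hR.pos N).le)).1.continuousAt
      ((hG.analyticAt_zero.continuousAt.mul (differentiable_linearProduct A 0).continuousAt).div
        (differentiable_linearProduct B 0).continuousAt (by simp)) (hgeq 0)
    simpa using h
  · have hpos := hR.pos N
    refine (norm_logDeriv_le_of_removed_divisor (A := A) (B := B) (K := C / R N) hpos hA0 hB0
      (fun a ha => ((hA a).1 ha).2) (fun b hb => ((hB b).1 hb).2) hgreg (hR.regular N) ?_
      (hR.bound N) hw).trans (le_of_eq ?_)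
    · intro z hz
      refine (ContinuousAt.eventuallyEq_nhds_iff_eventuallyEq_nhdsNE
        ((hgreg z hz.le).1.continuousAt.mul (differentiable_linearProduct B z).continuousAt)
        ((hR.regular N z hz).1.continuousAt.mul
          (differentiable_linearProduct A z).continuousAt)).1 ?_
      filter_upwards [hgeq z, linearProduct_eventually_ne_zero hB0 z] with ω h1 h2
      simp only [Pi.mul_apply] at *
      rw [h1, div_mul_cancel₀ _ h2]
    · have : R N - ‖w‖ ≠ 0 := by linarith
      field_simp

end IsRetardedCorrelator

/-! ### The thermal factor -/

/-- `F` is the entire function of order one which the thermal product hypothesis provides. -/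
structure IsThermalFactor (G : ℂ → ℂ) (β : ℝ) (F : ℂ → ℂ) : Prop where
  entire : IsEntireOfOrderOne F
  mul_spectralDensity : ∀ ω : ℂ, ¬ IsPoleOf G ω → ¬ IsPoleOf G (-ω) →
    F ω * spectralDensity G ω = Complex.sinh (β * ω / 2)
  zeroes : ∀ ω : ℂ, F ω = 0 → (IsPoleOf G ω ∨ IsPoleOf G (-ω)) ∧ deriv F ω ≠ 0

theorem spectralDensity_neg (G : ℂ → ℂ) (ω : ℂ) :
    spectralDensity G (-ω) = -spectralDensity G ω := by
  rw [spectralDensity, spectralDensity, neg_neg]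
  ring

theorem hasDerivAt_sinh_mul (β : ℝ) :
    HasDerivAt (fun ω : ℂ => Complex.sinh (β * ω / 2)) (β / 2) 0 := by
  have h : HasDerivAt (fun ω : ℂ => (β : ℂ) * ω / 2) (β / 2) 0 := by
    simpa using ((hasDerivAt_id (0 : ℂ)).const_mul (β : ℂ)).div_const 2
  simpa using h.csinh

theorem hasDerivAt_spectralDensity {G : ℂ → ℂ} (hG : IsRetardedCorrelator G) :
    HasDerivAt (spectralDensity G) (deriv G 0 / Complex.I) 0 := by
  have h1 := hG.analyticAt_zero.differentiableAt.hasDerivAt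
  have h2 : HasDerivAt (fun ω => G (-ω)) (-deriv G 0) 0 := by
    have h := HasDerivAt.comp (h₂ := G) (h := fun ω : ℂ => -ω) (h₂' := deriv G 0) 0
      (by simpa only [neg_zero] using h1) (hasDerivAt_neg 0)
    simpa [Function.comp_def] using h
  have h3 := (h1.sub h2).div_const (2 * Complex.I)
  refine h3.congr_deriv ?_
  field_simp
  ring

theorem deriv_zero_of_even {f : ℂ → ℂ} (h : ∀ z, f (-z) = f z) : deriv f 0 = 0 := by
  have h1 : deriv (fun z => f (-z)) 0 = -deriv f 0 := by rw [deriv_comp_neg, neg_zero]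
  simp only [h] at h1
  exact self_eq_neg.1 h1

namespace IsThermalFactor

variable {G F : ℂ → ℂ} {β : ℝ}

theorem differentiable (hF : IsThermalFactor G β F) : Differentiable ℂ F := hF.entire.1

/-- `F` is even, being the quotient of two odd functions near the origin. -/
theorem even (hβ : 0 < β) (hG : IsRetardedCorrelator G) (hF : IsThermalFactor G β F) (z : ℂ) :
    F (-z) = F z := by
  have h : (fun z => F (-z)) = F := by
    refine AnalyticOnNhd.eq_of_frequently_eq (z₀ := 0)
      (fun z _ => (hF.differentiable.comp differentiable_neg).analyticAt z)
      (fun z _ => hF.differentiable.analyticAt z) (Eventually.frequently ?_)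
    have hs : ∀ᶠ ω in 𝓝[≠] (0 : ℂ), Complex.sinh (β * ω / 2) ≠ 0 :=
      (hasDerivAt_sinh_mul β).eventually_ne (by simpa using hβ.ne')
    filter_upwards [hG.eventually_not_isPoleOf 0, hG.eventually_not_isPoleOf_neg 0, hs]
      with ω h1 h2 h3
    have e1 := hF.mul_spectralDensity ω h1 h2
    have e2 := hF.mul_spectralDensity (-ω) h2 (by rwa [neg_neg])
    rw [spectralDensity_neg, show (β : ℂ) * -ω / 2 = -(β * ω / 2) by ring, Complex.sinh_neg] at e2
    have h4 : spectralDensity G ω ≠ 0 := fun h => h3 (by rw [← e1, h, mul_zero])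
    refine mul_right_cancel₀ h4 ?_
    linear_combination -e2 - e1
  exact congrFun h z

/-- Derivative of `F ρ = sinh (β ω / 2)` at the origin, where `ρ` vanishes and `ρ' = G' / i`. -/
theorem apply_zero_mul_deriv (hG : IsRetardedCorrelator G) (hF : IsThermalFactor G β F) :
    F 0 * deriv G 0 = Complex.I * β / 2 := by
  have h1 := (hF.differentiable 0).hasDerivAt.mul (hasDerivAt_spectralDensity hG)
  have h0 : spectralDensity G 0 = 0 := by simp [spectralDensity]
  have hcont : ContinuousAt (F * spectralDensity G) 0 := h1.continuousAt
  have h2 : F * spectralDensity G =ᶠ[𝓝 0] fun ω : ℂ => Complex.sinh (β * ω / 2) := by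
    refine (ContinuousAt.eventuallyEq_nhds_iff_eventuallyEq_nhdsNE hcont
      (hasDerivAt_sinh_mul β).continuousAt).1 ?_
    filter_upwards [hG.eventually_not_isPoleOf 0, hG.eventually_not_isPoleOf_neg 0] with ω h1 h2
    exact hF.mul_spectralDensity ω h1 h2
  have h3 := h1.unique ((hasDerivAt_sinh_mul β).congr_of_eventuallyEq h2)
  rw [h0, mul_zero, zero_add] at h3
  have hI := Complex.I_ne_zero
  field_simp at h3
  linear_combination h3 / 2

theorem apply_zero_ne_zero (hβ : 0 < β) (hG : IsRetardedCorrelator G)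
    (hF : IsThermalFactor G β F) : F 0 ≠ 0 := by
  intro h
  have h1 := hF.apply_zero_mul_deriv hG
  rw [h, zero_mul] at h1
  have : (β : ℂ) ≠ 0 := by exact_mod_cast hβ.ne'
  exact (div_ne_zero (mul_ne_zero Complex.I_ne_zero this) two_ne_zero) h1.symm

/-- At a pole of `G` the spectral density has a pole too, since `G` is holomorphic at the mirror
image; the finiteness of `F ρ` there makes `F` vanish. -/
theorem apply_eq_zero_of_isPoleOf (hG : IsRetardedCorrelator G) (hF : IsThermalFactor G β F)
    {z : ℂ} (hz : IsPoleOf G z) : F z = 0 := by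
  by_contra hne
  have hFan := hF.differentiable.analyticAt z
  have hm : MeromorphicAt (fun ω => G (-ω)) z := (hG.meromorphicAt (-z)).comp_neg
  have hρ : spectralDensity G =
      (fun _ => (2 * Complex.I)⁻¹) * (G + (-fun ω => G (-ω))) := by
    funext ω
    simp only [spectralDensity, Pi.mul_apply, Pi.add_apply, Pi.neg_apply]
    ring
  have hordρ : meromorphicOrderAt (spectralDensity G) z = meromorphicOrderAt G z := by
    rw [hρ, meromorphicOrderAt_mul_of_ne_zero analyticAt_const (by simp),
      meromorphicOrderAt_add_eq_left_of_lt hm.neg]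
    rw [← meromorphicOrderAt_neg (f := fun ω => G (-ω)), meromorphicOrderAt_comp_neg]
    exact lt_of_lt_of_le hz (not_lt.1 (hG.not_isPoleOf_neg hz))
  have h1 : meromorphicOrderAt (F * spectralDensity G) z < 0 := by
    rw [meromorphicOrderAt_mul_of_ne_zero hFan hne, hordρ]
    exact hz
  have h2 : F * spectralDensity G =ᶠ[𝓝[≠] z] fun ω : ℂ => Complex.sinh (β * ω / 2) := by
    filter_upwards [hG.eventually_not_isPoleOf z, hG.eventually_not_isPoleOf_neg z] with ω h1 h2
    exact hF.mul_spectralDensity ω h1 h2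
  rw [meromorphicOrderAt_congr h2] at h1
  have hs : AnalyticAt ℂ (fun ω : ℂ => Complex.sinh (β * ω / 2)) z := by
    have : Differentiable ℂ (fun ω : ℂ => Complex.sinh (β * ω / 2)) := by fun_prop
    exact this.analyticAt z
  exact absurd hs.meromorphicOrderAt_nonneg (not_le.2 h1)

theorem meromorphicOrderAt_of_pole (hβ : 0 < β) (hG : IsRetardedCorrelator G)
    (hF : IsThermalFactor G β F) {z : ℂ} (hz : IsPoleOf G z ∨ IsPoleOf G (-z)) :
    meromorphicOrderAt F z = 1 := by
  have h0 : F z = 0 := by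
    rcases hz with hz | hz
    · exact hF.apply_eq_zero_of_isPoleOf hG hz
    · rw [← hF.even hβ hG]
      exact hF.apply_eq_zero_of_isPoleOf hG hz
  have han := hF.differentiable.analyticAt z
  have h1 := han.analyticOrderAt_sub_eq_one_of_deriv_ne_zero (hF.zeroes z h0).2
  simp only [h0, sub_zero] at h1
  rw [han.meromorphicOrderAt_eq, h1]
  rfl

theorem meromorphicOrderAt_of_not_pole (hF : IsThermalFactor G β F) {z : ℂ}
    (hz : ¬ IsPoleOf G z) (hz' : ¬ IsPoleOf G (-z)) : meromorphicOrderAt F z = 0 :=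
  (hF.differentiable.analyticAt z).meromorphicNFAt.meromorphicOrderAt_eq_zero_iff.2
    fun h => (hF.zeroes z h).1.elim hz hz'

/-- The entire function obtained from `F` by removing its zeroes in the disc of radius `r`. On the
circle of radius `2 r` the removed product has modulus at least one, so by the maximum principle
the quotient inherits the bound of `F` there. -/
theorem exists_removed_zeroes (hβ : 0 < β) (hG : IsRetardedCorrelator G)
    (hF : IsThermalFactor G β F) {r : ℝ} (hr : 0 < r) {A : Finset ℂ}
    (hA : ∀ z, z ∈ A ↔ IsPoleOf G z ∧ ‖z‖ < r) :
    ∃ Q : ℂ → ℂ, Differentiable ℂ Q ∧ (∀ z, ‖z‖ < r → Q z ≠ 0) ∧ Q 0 = F 0 ∧ deriv Q 0 = 0 ∧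
      (∀ z, Q z * (linearProduct A z * linearProduct A (-z)) = F z) ∧
      ∀ K, (∀ z, ‖z‖ = 2 * r → ‖F z‖ ≤ K) → ∀ z, ‖z‖ < r → ‖Q z‖ ≤ K := by
  have hA0 : (0 : ℂ) ∉ A := fun h => hG.not_isPoleOf_zero ((hA 0).1 h).1
  set P : ℂ → ℂ := fun z => linearProduct A z * linearProduct A (-z) with hP
  have hPd : Differentiable ℂ P :=
    (differentiable_linearProduct A).mul ((differentiable_linearProduct A).comp differentiable_neg)
  have hmA : ∀ z, MeromorphicAt (linearProduct A) z := fun z =>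
    (analyticAt_linearProduct A z).meromorphicAt
  have hordP : ∀ z, meromorphicOrderAt P z =
      meromorphicOrderAt (linearProduct A) z + meromorphicOrderAt (linearProduct A) (-z) := by
    intro z
    rw [← meromorphicOrderAt_comp_neg]
    exact meromorphicOrderAt_mul (hmA z) (hmA (-z)).comp_neg
  have hFP : ∀ z, meromorphicOrderAt (F / P) z = meromorphicOrderAt F z - meromorphicOrderAt P z :=
    fun z => meromorphicOrderAt_div (hF.differentiable.analyticAt z).meromorphicAt
      (hPd.analyticAt z).meromorphicAt
  have hP1 : ∀ z, z ∈ A ∨ -z ∈ A → meromorphicOrderAt P z = 1 := by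
    rintro z (hz | hz)
    · have hz' : -z ∉ A := fun h => hG.not_isPoleOf_neg ((hA _).1 hz).1 ((hA _).1 h).1
      rw [hordP, meromorphicOrderAt_linearProduct_of_mem hA0 hz,
        meromorphicOrderAt_linearProduct_of_notMem hA0 hz', add_zero]
    · have hz' : z ∉ A := fun h => hG.not_isPoleOf_neg ((hA _).1 h).1 ((hA _).1 hz).1
      rw [hordP, meromorphicOrderAt_linearProduct_of_mem hA0 hz,
        meromorphicOrderAt_linearProduct_of_notMem hA0 hz', zero_add]
  have hP0 : ∀ z, z ∉ A → -z ∉ A → meromorphicOrderAt P z = 0 := by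
    intro z hz hz'
    rw [hordP, meromorphicOrderAt_linearProduct_of_notMem hA0 hz,
      meromorphicOrderAt_linearProduct_of_notMem hA0 hz', zero_add]
  have hin : ∀ z, z ∈ A ∨ -z ∈ A → meromorphicOrderAt (F / P) z = 0 := by
    intro z hz
    have hpole : IsPoleOf G z ∨ IsPoleOf G (-z) :=
      hz.imp (fun h => ((hA _).1 h).1) fun h => ((hA _).1 h).1
    rw [hFP, hF.meromorphicOrderAt_of_pole hβ hG hpole, hP1 z hz]
    rfl
  have hnonneg : ∀ z, 0 ≤ meromorphicOrderAt (F / P) z := by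
    intro z
    by_cases hz : z ∈ A ∨ -z ∈ A
    · exact (hin z hz).ge
    · push Not at hz
      rw [hFP, hP0 z hz.1 hz.2, sub_zero]
      exact (hF.differentiable.analyticAt z).meromorphicOrderAt_nonneg
  have hzero : ∀ z, ‖z‖ < r → meromorphicOrderAt (F / P) z = 0 := by
    intro z hzr
    by_cases hz : z ∈ A ∨ -z ∈ A
    · exact hin z hz
    · push Not at hz
      rw [hFP, hP0 z hz.1 hz.2, sub_zero]
      exact hF.meromorphicOrderAt_of_not_pole (fun h => hz.1 ((hA _).2 ⟨h, hzr⟩))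
        fun h => hz.2 ((hA _).2 ⟨h, by rwa [norm_neg]⟩)
  obtain ⟨Q, hQ⟩ := exists_regularization (f := F / P)
    fun z => (hF.differentiable.analyticAt z).meromorphicAt.div (hPd.analyticAt z).meromorphicAt
  have hQd : Differentiable ℂ Q := fun z => ((hQ z).2.1 (hnonneg z)).differentiableAt
  have hQP : ∀ z, Q z * P z = F z := by
    intro z
    refine ContinuousAt.eq_of_eventuallyEq_nhdsNE (f := fun z => Q z * P z)
      ((hQd z).continuousAt.mul (hPd z).continuousAt) (hF.differentiable z).continuousAt ?_
    have hPne : ∀ᶠ w in 𝓝[≠] z, P w ≠ 0 := by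
      refine (meromorphicOrderAt_ne_top_iff_eventually_ne_zero
        (hPd.analyticAt z).meromorphicAt).1 ?_
      by_cases hz : z ∈ A ∨ -z ∈ A
      · rw [hP1 z hz]; decide
      · push Not at hz
        rw [hP0 z hz.1 hz.2]; decide
    filter_upwards [(hQ z).1, hPne] with w h1 h2
    rw [h1, Pi.div_apply, div_mul_cancel₀ _ h2]
  have hP00 : P 0 = 1 := by simp [hP]
  have hQ0 : Q 0 = F 0 := by rw [← hQP 0, hP00, mul_one]
  refine ⟨Q, hQd, fun z hz => (hQ z).2.2.2 (hzero z hz), hQ0, ?_, hQP, ?_⟩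
  · have h1 : deriv F 0 = 0 := deriv_zero_of_even (hF.even hβ hG)
    have h2 : deriv P 0 = 0 := deriv_zero_of_even fun z => by simp only [hP, neg_neg]; ring
    have h3 : F = Q * P := by
      funext z; exact (hQP z).symm
    rw [h3, deriv_mul (hQd 0) (hPd 0), h2, hP00] at h1
    simpa using h1
  · intro K hK z hz
    have hAr : ∀ a ∈ A, a ≠ 0 ∧ ‖a‖ < r := fun a ha =>
      ⟨by rintro rfl; exact hA0 ha, ((hA a).1 ha).2⟩
    refine Complex.norm_le_of_forall_mem_frontier_norm_le (U := Metric.ball (0 : ℂ) (2 * r))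
      Metric.isBounded_ball hQd.diffContOnCl (fun w hw => ?_)
      (subset_closure (by rw [mem_ball_zero_iff]; linarith))
    rw [frontier_ball _ (by positivity), mem_sphere_zero_iff_norm] at hw
    have h1 := one_le_norm_linearProduct hAr hw.ge
    have h2 := one_le_norm_linearProduct hAr (z := -w) (by rw [norm_neg]; exact hw.ge)
    calc ‖Q w‖ = ‖Q w‖ * (1 * 1) := by ring
      _ ≤ ‖Q w‖ * (‖linearProduct A w‖ * ‖linearProduct A (-w)‖) := by gcongr
      _ = ‖F w‖ := by rw [← hQP w, hP, norm_mul, norm_mul]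
      _ ≤ K := hK w hw

/-- The growth hypothesis at `ε = 1 / 2`; any `ε < 1` would serve. -/
theorem eventually_norm_le (hF : IsThermalFactor G β F) :
    ∀ᶠ x : ℝ in atTop, ∀ z : ℂ, ‖z‖ = x → ‖F z‖ ≤ Real.exp (x ^ (3 / 2 : ℝ)) := by
  have h := hF.entire.2 (1 / 2) (by norm_num)
  rw [hasBasis_cobounded_norm.eventually_iff] at h
  obtain ⟨x₀, -, hx₀⟩ := h
  filter_upwards [eventually_ge_atTop x₀] with x hx z hz
  have h1 := hx₀ (x := z) (by simpa [hz] using hx)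
  rw [hz, show (1 : ℝ) + 1 / 2 = 3 / 2 by norm_num] at h1
  rcases eq_or_ne (F z) 0 with h0 | h0
  · rw [h0, norm_zero]; positivity
  · rw [← Real.exp_log (norm_pos_iff.2 h0)]
    exact Real.exp_le_exp.2 h1.le

end IsThermalFactor

/-! ### The limit of the partial products -/

/-- The product `F(ω) G(-ω)` extends to an entire function: the simple poles of `G(-ω)` cancel
against the simple zeroes `-ωₙ⁺` of `F`, so that of the zeroes of `F` only the `ωₙ⁺` survive. -/
theorem exists_entire_mul_reflection {G F : ℂ → ℂ} {β : ℝ} (hβ : 0 < β)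
    (hG : IsRetardedCorrelator G) (hF : IsThermalFactor G β F) :
    ∃ T : ℂ → ℂ, Differentiable ℂ T ∧ (∀ z, T =ᶠ[𝓝[≠] z] fun ω => F ω * G (-ω)) ∧
      ∀ z, T z = 0 ↔ IsPoleOf G z ∨ IsZeroOf G (-z) := by
  have hmF : ∀ z, MeromorphicAt F z := fun z => (hF.differentiable.analyticAt z).meromorphicAt
  have hmG : ∀ z, MeromorphicAt (fun ω => G (-ω)) z := fun z => (hG.meromorphicAt (-z)).comp_neg
  have hord : ∀ z, meromorphicOrderAt (fun ω => F ω * G (-ω)) z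
      = meromorphicOrderAt F z + meromorphicOrderAt G (-z) := by
    intro z
    rw [← meromorphicOrderAt_comp_neg G]
    exact meromorphicOrderAt_mul (hmF z) (hmG z)
  have hcases : ∀ z, 0 ≤ meromorphicOrderAt (fun ω => F ω * G (-ω)) z ∧
      (meromorphicOrderAt (fun ω => F ω * G (-ω)) z = 0 ↔
        ¬ (IsPoleOf G z ∨ IsZeroOf G (-z))) := by
    intro z
    rw [hord]
    by_cases h1 : IsPoleOf G z
    · have h2 : 0 ≤ meromorphicOrderAt G (-z) := not_lt.1 (hG.not_isPoleOf_neg h1)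
      rw [hF.meromorphicOrderAt_of_pole hβ hG (Or.inl h1)]
      have h3 : (1 : WithTop ℤ) ≤ 1 + meromorphicOrderAt G (-z) := le_add_of_nonneg_right h2
      have h4 : (0 : WithTop ℤ) < 1 + meromorphicOrderAt G (-z) := lt_of_lt_of_le (by decide) h3
      exact ⟨h4.le, by simp [h1, h4.ne']⟩
    · by_cases h2 : IsPoleOf G (-z)
      · have h3 : ¬ IsZeroOf G (-z) := fun h => lt_asymm h2 h
        rw [hF.meromorphicOrderAt_of_pole hβ hG (Or.inr h2), hG.meromorphicOrderAt_of_isPoleOf h2]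
        have h4 : (1 : WithTop ℤ) + -1 = 0 := rfl
        rw [h4]
        simp [h1, h3]
      · rw [hF.meromorphicOrderAt_of_not_pole h1 h2, zero_add]
        have h3 : 0 ≤ meromorphicOrderAt G (-z) := not_lt.1 h2
        refine ⟨h3, ?_⟩
        simp only [h1, false_or, IsZeroOf, not_lt]
        exact ⟨fun h => h.le, fun h => le_antisymm h h3⟩
  obtain ⟨T, hT⟩ := exists_regularization (f := fun ω => F ω * G (-ω))
    fun z => (hmF z).mul (hmG z)
  refine ⟨T, fun z => ((hT z).2.1 (hcases z).1).differentiableAt, fun z => (hT z).1, fun z => ?_⟩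
  rw [← not_iff_not, ← (hcases z).2]
  exact (hT z).2.2

/-- The growth exponent `3 / 2` allowed for `log |F|` is less than `2`, the order to which the
logarithm of a normalised even function vanishes at the origin. -/
theorem tendsto_growth_div_sq (k : ℝ) :
    Tendsto (fun x : ℝ => ((2 * x) ^ (3 / 2 : ℝ) + k) / x ^ 2) atTop (𝓝 0) := by
  have h1 : Tendsto (fun x : ℝ => (2 : ℝ) ^ (3 / 2 : ℝ) * x ^ (-(1 / 2) : ℝ) + k * (x ^ 2)⁻¹)
      atTop (𝓝 ((2 : ℝ) ^ (3 / 2 : ℝ) * 0 + k * 0)) :=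
    ((tendsto_rpow_neg_atTop (by norm_num)).const_mul _).add
      (((tendsto_pow_atTop two_ne_zero).inv_tendsto_atTop).const_mul _)
  rw [mul_zero, mul_zero, add_zero] at h1
  refine h1.congr' ?_
  filter_upwards [eventually_gt_atTop 0] with x hx
  rw [Real.mul_rpow (by norm_num) hx.le, add_div, mul_div_assoc, ← Real.rpow_natCast x 2,
    ← Real.rpow_sub hx, ← div_eq_mul_inv, Real.rpow_natCast]
  norm_num

/-- The partial products differ from the entire function `F(ω) G(-ω) / (F(0) G(0))` by factors
`exp l` with `l` small on compact sets: one part of `l` comes from the Hadamard product of `F`, the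
other from the product expansion of `G`. -/
theorem eventually_partialProduct_mul_exp {G F T : ℂ → ℂ} {β : ℝ} {R : ℕ → ℝ} {C : ℝ} (hβ : 0 < β)
    (hG : IsRetardedCorrelator G) (hR : HasPowerLawBound G R C) (hF : IsThermalFactor G β F)
    (hTd : Differentiable ℂ T) (hT : ∀ z, T =ᶠ[𝓝[≠] z] fun ω => F ω * G (-ω))
    {r ε : ℝ} (hr : 0 < r) (hε : 0 < ε) :
    ∀ᶠ N in atTop, ∀ z, ‖z‖ ≤ r → ∃ l : ℂ, ‖l‖ ≤ ε ∧
      T z / (F 0 * G 0) =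
        polePartialProduct G (R N) z * zeroPartialProduct G (R N) (-z) * Complex.exp l := by
  have hF0 := hF.apply_zero_ne_zero hβ hG
  set k := |Real.log ‖F 0‖| with hk
  have hgrowth : ∀ᶠ N in atTop, 8 * (((2 * R N) ^ (3 / 2 : ℝ) + k) / R N ^ 2) * r ^ 2 ≤ ε / 2 := by
    have h := (((tendsto_growth_div_sq k).comp hR.tendsto).const_mul 8).mul_const (r ^ 2)
    rw [mul_zero, zero_mul] at h
    exact h.eventually_le_const (by positivity)
  have hsmall : ∀ᶠ N in atTop, C / (R N - r) * r ≤ ε / 2 := by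
    have h : Tendsto (fun N => C / (R N - r) * r) atTop (𝓝 (0 * r)) :=
      ((tendsto_atTop_add_const_right atTop (-r) hR.tendsto).const_div_atTop C).mul_const r
    rw [zero_mul] at h
    exact h.eventually_le_const (by positivity)
  have hC : 0 ≤ C := by
    have h := (norm_nonneg _).trans (hR.bound 0 (R 0) (by simp [abs_of_pos (hR.pos 0)]))
    have h' := hR.pos 0
    by_contra! hneg
    exact absurd h (not_le.2 (div_neg_of_neg_of_pos hneg h'))
  have hbound : ∀ᶠ N in atTop, ∀ z : ℂ, ‖z‖ = 2 * R N →
      ‖F z‖ ≤ Real.exp ((2 * R N) ^ (3 / 2 : ℝ)) :=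
    (hR.tendsto.const_mul_atTop (two_pos)).eventually hF.eventually_norm_le
  filter_upwards [hgrowth, hsmall, hbound, hR.tendsto.eventually_gt_atTop (2 * r)]
    with N h1 h2 h3 h4 z hz
  have hRN := hR.pos N
  obtain ⟨A, hA, hAe⟩ := hG.exists_polePartialProduct_eq (R N)
  obtain ⟨B, hB, hBe⟩ := hG.exists_zeroPartialProduct_eq (R N)
  have hB0 : (0 : ℂ) ∉ B := fun h => hG.not_isZeroOf_zero ((hB 0).1 h).1
  rw [hAe, hBe]
  obtain ⟨g, hg, hg0, hgeq, hglog⟩ := hG.exists_removed_divisor hR N hA hB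
  obtain ⟨Q, hQd, hQne, hQ0, hQ', hQP, hQb⟩ := hF.exists_removed_zeroes hβ hG hRN hA
  -- `Q` is bounded by `exp M` times its value at `0`, with `M = o(R N ^ 2)`
  set M : ℝ := (2 * R N) ^ (3 / 2 : ℝ) + k with hM
  have hMpos : 0 < M := add_pos_of_pos_of_nonneg (by positivity) (abs_nonneg _)
  have hQM : ∀ w ∈ Metric.ball (0 : ℂ) (R N), ‖Q w‖ ≤ ‖Q 0‖ * Real.exp M := by
    intro w hw
    refine (hQb _ h3 w (by simpa using hw)).trans ?_
    have hlog : -k ≤ Real.log ‖F 0‖ := neg_abs_le _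
    rw [hQ0, show ‖F 0‖ * Real.exp M = Real.exp (Real.log ‖F 0‖ + M) by
      rw [Real.exp_add (Real.log ‖F 0‖), Real.exp_log (norm_pos_iff.2 hF0)]]
    exact Real.exp_le_exp.2 (by rw [hM]; linarith)
  obtain ⟨l₁, hl₁, hQl⟩ := exists_small_log_of_deriv_eq_zero hRN hMpos hQd.differentiableOn
    (fun w hw => hQne w (by simpa using hw)) hQ' hQM z (by linarith)
  have hsR : r < R N := by linarith
  obtain ⟨l₂, hl₂, hgl⟩ := exists_small_log_of_logDeriv_bound (f := g) (K := C / (R N - r)) hr.le hsR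
    (fun w hw => (hg w (mem_ball_zero_iff.1 hw).le).1.differentiableAt.differentiableWithinAt)
    (fun w hw => (hg w (mem_ball_zero_iff.1 hw).le).2)
    (fun w hw => (hglog w (by linarith)).trans
      (div_le_div_of_nonneg_left hC (by linarith) (by linarith))) (-z) (by rwa [norm_neg])
  -- both sides are continuous at `z` and agree away from the poles of `G`
  have hid : T z = linearProduct A z * linearProduct B (-z) * (Q z * g (-z)) := by
    have hneg := tendsto_neg_nhdsNE_neg z
    have hgc : ContinuousAt (fun w => g (-w)) z :=
      ContinuousAt.comp (g := g) (hg (-z) (by rw [norm_neg]; linarith)).1.continuousAt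
        continuous_neg.continuousAt
    have hBc : Continuous (fun w => linearProduct B (-w)) :=
      (differentiable_linearProduct B).continuous.comp continuous_neg
    refine ContinuousAt.eq_of_eventuallyEq_nhdsNE (hTd z).continuousAt
      (g := fun z => linearProduct A z * linearProduct B (-z) * (Q z * g (-z)))
      (((differentiable_linearProduct A z).continuousAt.mul hBc.continuousAt).mul
        ((hQd z).continuousAt.mul hgc)) ?_
    filter_upwards [hT z, hneg.eventually (hgeq (-z)),
      hneg.eventually (linearProduct_eventually_ne_zero hB0 (-z))] with w e1 e2 e3
    rw [e1, e2, ← hQP w]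
    field_simp
  refine ⟨l₁ + l₂, ?_, ?_⟩
  · have hb₁ : ‖l₁‖ ≤ ε / 2 := by
      refine hl₁.trans (le_trans ?_ h1)
      rw [mul_div_assoc', div_mul_eq_mul_div]
      gcongr
    have hb₂ : ‖l₂‖ ≤ ε / 2 := by
      refine hl₂.trans (le_trans ?_ h2)
      rw [norm_neg]
      have : 0 ≤ C / (R N - r) := div_nonneg hC (by linarith)
      gcongr
    exact (norm_add_le _ _).trans (by linarith)
  · rw [hid, hQl, hgl, hQ0, hg0, Complex.exp_add]
    have := hG.ne_zero_at_zero
    field_simp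

/-! ### The product formula -/

theorem mainTheorem1 (G : ℂ → ℂ) (β : ℝ) (R : ℕ → ℝ) (C : ℝ) (hβ : 0 < β)
    (hG : IsRetardedCorrelator G) (hR : HasPowerLawBound G R C)
    (hT : ThermalProductHypothesis G β) :
    ∃ (S : ℂ → ℂ) (μ lam : ℝ),
      Differentiable ℂ S ∧
      TendstoLocallyUniformly
        (fun (N : ℕ) (ω : ℂ) => polePartialProduct G (R N) ω * zeroPartialProduct G (R N) (-ω))
        S atTop ∧
      (∀ ω : ℂ, S ω = 0 ↔ IsPoleOf G ω ∨ IsZeroOf G (-ω)) ∧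
      HasDerivAt G (Complex.I / 2 * μ * β) 0 ∧
      μ ≠ 0 ∧
      ((∀ x : ℝ, 0 ≤ x * (spectralDensity G x).re) → 0 < μ) ∧
      (lam : ℂ) = -(μ : ℂ) / G 0 ∧
      ∀ ω : ℂ, S ω - S (-ω) = 2 * Complex.I * lam * Complex.sinh (β * ω / 2) := by
  obtain ⟨F, hF1, hF2, hF3⟩ := hT
  have hF : IsThermalFactor G β F := ⟨hF1, hF2, hF3⟩
  obtain ⟨T, hTd, hTe, hT0⟩ := exists_entire_mul_reflection hβ hG hF
  have hF0 := hF.apply_zero_ne_zero hβ hG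
  have hG0 := hG.ne_zero_at_zero
  have hβ' : (β : ℂ) ≠ 0 := by exact_mod_cast hβ.ne'
  have hI := Complex.I_ne_zero
  set μ : ℝ := 2 * (deriv G 0).im / β with hμ
  have hd : deriv G 0 = Complex.I / 2 * μ * β := by
    apply Complex.ext <;> simp [hG.re_deriv_zero, hμ]
    field_simp
  have hFμ : F 0 * μ = 1 := by
    have h := hF.apply_zero_mul_deriv hG
    rw [hd] at h
    have h' : Complex.I * β / 2 ≠ 0 := div_ne_zero (mul_ne_zero hI hβ') two_ne_zero
    refine mul_right_cancel₀ h' ?_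
    linear_combination h
  have hμ0 : μ ≠ 0 := by
    intro h
    rw [h] at hFμ
    simp at hFμ
  have hGre : ((G 0).re : ℂ) = G 0 := Complex.ext (by simp) (by simp [hG.im_apply_zero])
  refine ⟨fun ω => T ω / (F 0 * G 0), μ, -μ / (G 0).re, hTd.div_const _,
    tendstoLocallyUniformly_of_eq_mul_exp (hTd.div_const _).continuous fun r ε hr hε =>
      eventually_partialProduct_mul_exp hβ hG hR hF hTd hTe hr hε, fun ω => ?_, ?_, hμ0, ?_, ?_, ?_⟩
  · rw [div_eq_zero_iff, or_iff_left (mul_ne_zero hF0 hG0)]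
    exact hT0 ω
  · rw [← hd]
    exact hG.analyticAt_zero.differentiableAt.hasDerivAt
  · -- `ρ'(0) = μ β / 2` is the limit of `ρ(x) / x` along the reals
    intro hpos
    have h1 := hasDerivAt_spectralDensity hG
    have h2 : HasDerivAt (fun x : ℝ => (spectralDensity G x).re) (μ * β / 2) 0 := by
      have h := HasDerivAt.real_of_complex (e := spectralDensity G)
        (e' := deriv G 0 / Complex.I) (z := 0) (by rwa [Complex.ofReal_zero])
      refine h.congr_deriv ?_
      rw [hd, show Complex.I / 2 * μ * β / Complex.I = ((μ * β / 2 : ℝ) : ℂ) by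
        push_cast; field_simp, Complex.ofReal_re]
    have h3 : 0 ≤ μ * β / 2 := by
      have hs := hasDerivAt_iff_tendsto_slope.1 h2
      refine ge_of_tendsto hs (Filter.Eventually.of_forall fun x => ?_)
      have h0 : spectralDensity G ((0 : ℝ) : ℂ) = 0 := by simp [spectralDensity]
      rw [slope_def_field, h0, Complex.zero_re, sub_zero, sub_zero]
      rw [show (spectralDensity G x).re / x = x * (spectralDensity G x).re / x ^ 2 by
        rcases eq_or_ne x 0 with rfl | hx
        · simp
        · field_simp]
      exact div_nonneg (hpos x) (sq_nonneg x)
    have h4 : 0 ≤ μ := by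
      by_contra! h
      nlinarith
    exact lt_of_le_of_ne h4 hμ0.symm
  · push_cast
    rw [hGre]
  · intro ω
    have hTn : Continuous fun ω => T (-ω) := hTd.continuous.comp continuous_neg
    have hsinh : Continuous fun ω : ℂ => 2 * Complex.I * ((-μ / (G 0).re : ℝ) : ℂ) *
        Complex.sinh (β * ω / 2) := by fun_prop
    refine ContinuousAt.eq_of_eventuallyEq_nhdsNE
      (f := fun ω => T ω / (F 0 * G 0) - T (-ω) / (F 0 * G 0))
      ((hTd.continuous.div_const _).sub (hTn.div_const _)).continuousAt hsinh.continuousAt ?_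
    have hneg := tendsto_neg_nhdsNE_neg ω
    filter_upwards [hTe ω, hneg.eventually (hTe (-ω)), hG.eventually_not_isPoleOf ω,
      hG.eventually_not_isPoleOf_neg ω] with w e1 e2 e3 e4
    have e5 := hF.mul_spectralDensity w e3 e4
    have e6 : (μ : ℂ) = 1 / F 0 := by
      field_simp
      linear_combination hFμ
    rw [e1, e2, hF.even hβ hG, neg_neg, ← e5, spectralDensity]
    push_cast
    rw [hGre, e6]
    field_simp
    ring
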